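/- Write $\mathbb T=\mathbb R/2\pi\mathbb Z$. Let $(w,z,k,a)$ be a solution of class $C^2$ on $\mathbb T\times[-\varepsilon,T)$ (one-sided in $t$ at $t=-\varepsilon$) of the azimuthal Euler system $$\partial_t w+\lambda_3\partial_\theta w=-\tfrac83 aw+\tfrac1{24}(w-z)^2\partial_\theta k,\qquad \partial_t z+\lambda_1\partial_\theta z=-\tfrac83 az+\tfrac1{24}(w-z)^2\partial_\theta k,$$ $$\partial_t k+\lambda_2\partial_\theta k=0,\qquad \partial_t a+\lambda_2\partial_\theta a=-\tfrac43a^2+\tfrac13(w+z)^2-\tfrac16(w-z)^2,$$ where $\lambda_1=\tfrac13w+z$, $\lambda_2=\tfrac23w+\tfrac23z$, $\lambda_3=w+\tfrac13z$, and put $c=\tfrac12(w-z)$. **Lemma.** For every $M\ge 1$ there is a constant $C>0$, depending only on $M$, with the following property. Let $\beta_1>-1$, $\gamma_1>0$, $0<\varepsilon\le1$ and $-\varepsilon\le T\le\varepsilon$, let $(w,z,k,a)$ be a solution as above whose initial slope satisfies $|\partial_\theta w(\theta,-\varepsilon)|\le\frac1\varepsilon$ for all $\theta$, and suppose that on $\mathbb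 T\times[-\varepsilon,T)$ $$\tfrac1M\le w\le M,\quad \tfrac1M\le c\le M,\quad |k|,|a|\le M,\quad |\partial_\theta z|\le M\varepsilon^{\beta_1},\quad |\partial_\theta k|\le M\varepsilon^{\gamma_1},\quad |\partial_\theta a|\le M.$$ Let $\varphi>0$ and let $\Psi$ be the flow of the speed $\lambda=(1-\varphi)w+(\tfrac13+\varphi)z$, that is, $\Psi(x,-\varepsilon)=x$ and $\partial_t\Psi(x,t)=\lambda(\Psi(x,t),t)$ for $t\in[-\varepsilon,T)$. Then for all $x$ and all $t\in[-\varepsilon,T]$ the function $\tau\mapsto|\partial_\theta w(\Psi(x,\tau),\tau)|$ is integrable on $[-\varepsilon,t]$ and $$\int_{-\varepsilon}^t|\partial_\theta w(\Psi(x,\tau),\tau)|\,d\tau\;\le\; C\,\max\Big(1,\frac1\varphi\Big)\,\frac{\varepsilon+t}{\varepsilon}.$$ In particular, for $0<\varphi\le1$, which includes the first and second wave speeds $\lambda_1$ ($\varphi=\tfrac23$), $\lambda_2$ ($\varphi=\tfrac13$) and every speed between $\lambda_1$ and $\lambda_3$, the bound is $\frac C\varphi\,\frac{\varepsilon+t}\varepsilon$,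 with $C$ uniform in $\varphi$, $x$, $t$ and $\varepsilon$. -/

import Mathlib

/-!
Functions on the circle of length `2 * π` are represented by `2 * π`-periodic functions of a
real variable `θ`.  A space-time function is `f : ℝ → ℝ → ℝ`, with `f θ t` its value at the angle
`θ` and the time `t`.
-/

namespace AzimuthalEuler

/-- The time interval `[-ε, T)`. -/
def timeInterval (ε T : ℝ) : Set ℝ := Set.Ico (-ε) T

/-- The partial derivative of `f` in `θ`. -/
noncomputable def dTheta (f : ℝ → ℝ → ℝ) (θ t : ℝ) : ℝ := deriv (fun x => f x t) θ

/-- The partial derivative of `f` in `t` on `[-ε, T)`, which is one-sided at `t = -ε`. -/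
noncomputable def dTime (ε T : ℝ) (f : ℝ → ℝ → ℝ) (θ t : ℝ) : ℝ :=
  derivWithin (fun s => f θ s) (timeInterval ε T) t

/-- The sound speed `c = (w - z) / 2`. -/
noncomputable def soundSpeed (w z : ℝ → ℝ → ℝ) (θ t : ℝ) : ℝ := (w θ t - z θ t) / 2

/-- The first wave speed `w / 3 + z`. -/
noncomputable def lam1 (w z : ℝ → ℝ → ℝ) (θ t : ℝ) : ℝ := 1 / 3 * w θ t + z θ t

/-- The second wave speed `2 w / 3 + 2 z / 3`. -/
noncomputable def lam2 (w z : ℝ → ℝ → ℝ) (θ t : ℝ) : ℝ := 2 / 3 * w θ t + 2 / 3 * z θ t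

/-- The third wave speed `w + z / 3`. -/
noncomputable def lam3 (w z : ℝ → ℝ → ℝ) (θ t : ℝ) : ℝ := w θ t + 1 / 3 * z θ t

/-- The speed `(1 - φ) w + (1 / 3 + φ) z`; it is the third, second and first wave speed for
`φ = 0`, `φ = 1 / 3` and `φ = 2 / 3`. -/
noncomputable def speed (φ : ℝ) (w z : ℝ → ℝ → ℝ) (θ t : ℝ) : ℝ :=
  (1 - φ) * w θ t + (1 / 3 + φ) * z θ t

/-- `f` is `2 * π`-periodic in `θ` and of class `C²` on `𝕋 × [-ε, T)`, up to the initial time. -/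
structure IsRegular (ε T : ℝ) (f : ℝ → ℝ → ℝ) : Prop where
  periodic : ∀ t ∈ timeInterval ε T, Function.Periodic (fun θ => f θ t) (2 * Real.pi)
  contDiffOn : ContDiffOn ℝ 2 (Function.uncurry f) (Set.univ ×ˢ timeInterval ε T)

/-- `(w, z, k, a)` is a classical solution on `𝕋 × [-ε, T)` of the 2d Euler equations in azimuthal
symmetry with adiabatic exponent `2`, written in the Riemann variables `w`, `z`, the entropy `k`
and the (rescaled) radial velocity `a`. -/
structure IsSolution (ε T : ℝ) (w z k a : ℝ → ℝ → ℝ) : Prop where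
  regular_w : IsRegular ε T w
  regular_z : IsRegular ε T z
  regular_k : IsRegular ε T k
  regular_a : IsRegular ε T a
  eq_w : ∀ θ, ∀ t ∈ timeInterval ε T,
    dTime ε T w θ t + lam3 w z θ t * dTheta w θ t =
      -(8 / 3) * a θ t * w θ t + 1 / 24 * (w θ t - z θ t) ^ 2 * dTheta k θ t
  eq_z : ∀ θ, ∀ t ∈ timeInterval ε T,
    dTime ε T z θ t + lam1 w z θ t * dTheta z θ t =
      -(8 / 3) * a θ t * z θ t + 1 / 24 * (w θ t - z θ t) ^ 2 * dTheta k θ t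
  eq_k : ∀ θ, ∀ t ∈ timeInterval ε T,
    dTime ε T k θ t + lam2 w z θ t * dTheta k θ t = 0
  eq_a : ∀ θ, ∀ t ∈ timeInterval ε T,
    dTime ε T a θ t + lam2 w z θ t * dTheta a θ t =
      -(4 / 3) * a θ t ^ 2 + 1 / 3 * (w θ t + z θ t) ^ 2 - 1 / 6 * (w θ t - z θ t) ^ 2

/-- `Ψ x t` is the flow of the speed `v`, started from the identity at time `-ε`.  (It takes values
in `ℝ`: it is the lift of the flow on the circle.) -/
structure IsFlow (ε T : ℝ) (v Ψ : ℝ → ℝ → ℝ) : Prop where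
  initial : ∀ x, Ψ x (-ε) = x
  hasDeriv : ∀ x, ∀ t ∈ timeInterval ε T,
    HasDerivWithinAt (fun s => Ψ x s) (v (Ψ x t) t) (timeInterval ε T) t

/-- The pointwise bounds on `𝕋 × [-ε, T)`, with implicit constant `M`: `w ∼ 1`, `c ∼ 1`,
`|k|, |a| ≲ 1`, `|∂_θ z| ≲ ε ^ β₁`, `|∂_θ k| ≲ ε ^ γ₁`, `|∂_θ a| ≲ 1`. -/
structure HasBounds (M β₁ γ₁ ε T : ℝ) (w z k a : ℝ → ℝ → ℝ) : Prop where
  w_sim : ∀ θ, ∀ t ∈ timeInterval ε T, 1 / M ≤ w θ t ∧ w θ t ≤ M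
  c_sim : ∀ θ, ∀ t ∈ timeInterval ε T, 1 / M ≤ soundSpeed w z θ t ∧ soundSpeed w z θ t ≤ M
  k_le : ∀ θ, ∀ t ∈ timeInterval ε T, |k θ t| ≤ M
  a_le : ∀ θ, ∀ t ∈ timeInterval ε T, |a θ t| ≤ M
  dz_le : ∀ θ, ∀ t ∈ timeInterval ε T, |dTheta z θ t| ≤ M * ε ^ β₁
  dk_le : ∀ θ, ∀ t ∈ timeInterval ε T, |dTheta k θ t| ≤ M * ε ^ γ₁
  da_le : ∀ θ, ∀ t ∈ timeInterval ε T, |dTheta a θ t| ≤ M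

end AzimuthalEuler

/-!
The corrected slope `q = ∂_θ w - (w - z) / 8 * ∂_θ k` satisfies a Riccati equation
`∂_t q + λ₃ ∂_θ q = -(∂_θ w)² - P ∂_θ w + R` with `|P| ≤ 4 L` and `|R| ≤ 4 L²`, where `L = M² / ε`.
By the maximum principle `∂_θ w ≤ 7 L` at all times, and `|∂_θ w| ≤ 7 L` as long as
`40 L (ε + t) ≤ 1`; later on `∂_θ w` may become very negative. Along a curve with speed
`λ₃ - 2 φ c`, however, `w` has derivative `S - 2 φ c ∂_θ w` with `|S| ≤ 3 M³ / ε`, so that the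
integral of `c ∂_θ w` is controlled by the oscillation of `w`, and the upper bound on `∂_θ w` turns
this into a bound on the integral of `c |∂_θ w|`. The oscillation of `w` contributes a constant and
not a multiple of `ε + t`, which is harmless once `40 L (ε + t) ≥ 1`.
-/

namespace AzimuthalEuler

open Set Filter Topology MeasureTheory

theorem nonneg_of_isMaxOn_right_endpoint {f : ℝ → ℝ} {a b m : ℝ} (hab : a < b)
    (hmax : IsMaxOn f (Icc a b) b) (hf : HasDerivAt f m b) : 0 ≤ m := by
  have hdir : a - b ∈ posTangentConeAt (Icc a b) b :=
    sub_mem_posTangentConeAt_of_segment_subset (segment_symm ℝ a b ▸ segment_subset_Icc hab.le)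
  have hm : (a - b) * m ≤ 0 := by
    simpa using hmax.localize.hasFDerivWithinAt_nonpos hf.hasDerivWithinAt.hasFDerivWithinAt hdir
  nlinarith

theorem exists_first_zero_of_periodic {g : ℝ → ℝ → ℝ} {t₀ t₁ P : ℝ} (hP : 0 < P)
    (hcont : ContinuousOn (Function.uncurry g) (univ ×ˢ Icc t₀ t₁))
    (hper : ∀ t ∈ Icc t₀ t₁, Function.Periodic (fun θ => g θ t) P)
    (hinit : ∀ θ, g θ t₀ < 0) (hpos : ∃ θ, ∃ t ∈ Icc t₀ t₁, 0 ≤ g θ t) :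
    ∃ θ, ∃ t ∈ Ioc t₀ t₁, g θ t = 0 ∧ ∀ x, ∀ s ∈ Icc t₀ t, g x s ≤ 0 := by
  let K : Set (ℝ × ℝ) := (Icc 0 P ×ˢ Icc t₀ t₁) ∩ Function.uncurry g ⁻¹' Ici 0
  have hK : IsCompact K :=
    (isCompact_Icc.prod isCompact_Icc).of_isClosed_subset
      ((hcont.mono (prod_mono_left (subset_univ _))).preimage_isClosed_of_isClosed
        (isClosed_Icc.prod isClosed_Icc) isClosed_Ici) inter_subset_left
  have exists_mem_K : ∀ x, ∀ s ∈ Icc t₀ t₁, 0 ≤ g x s → ∃ y, (y, s) ∈ K := fun x s hs h => by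
    obtain ⟨y, hy, hxy⟩ := (hper s hs).exists_mem_Ico₀ hP x
    exact ⟨y, ⟨Ico_subset_Icc_self hy, hs⟩, h.trans_eq hxy⟩
  obtain ⟨θ₁, s₁, hs₁, hg₁⟩ := hpos
  obtain ⟨y₁, hy₁⟩ := exists_mem_K θ₁ s₁ hs₁ hg₁
  obtain ⟨⟨θ, t⟩, ⟨⟨-, ht⟩, hnonneg⟩, hmin⟩ :=
    hK.exists_isMinOn ⟨_, hy₁⟩ continuous_snd.continuousOn
  have hbefore : ∀ x, ∀ s ∈ Ico t₀ t, g x s < 0 := by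
    intro x s hs
    by_contra! h
    obtain ⟨y, hy⟩ := exists_mem_K x s ⟨hs.1, hs.2.le.trans ht.2⟩ h
    exact hs.2.not_ge (hmin hy)
  have ht₀ : t₀ < t := ht.1.lt_of_ne fun h => (hinit θ).not_ge (h ▸ hnonneg)
  have hle : ∀ x, ∀ s ∈ Icc t₀ t, g x s ≤ 0 := by
    intro x s hs
    rw [← closure_Ico ht₀.ne] at hs
    have hgx : ContinuousOn (fun s => g x s) (closure (Ico t₀ t)) :=
      hcont.comp (f := fun s => (x, s)) (by fun_prop) fun s hs =>
        ⟨mem_univ _, Icc_subset_Icc_right ht.2 (closure_Ico ht₀.ne ▸ hs)⟩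
    exact ((hgx s hs).mono subset_closure).closure_le hs continuousWithinAt_const
      fun s hs => (hbefore x s hs).le
  exact ⟨θ, t, ⟨ht₀, ht.2⟩, (hle θ t ⟨ht.1, le_rfl⟩).antisymm hnonneg, hle⟩

/-- The transport derivative `∂_t v + c ∂_θ v` at `(θ, t)`, for the speed `c`, exists and has the
value `m`. -/
def HasTransportDerivAt (v : ℝ → ℝ → ℝ) (c m θ t : ℝ) : Prop :=
  ∃ vθ vt, HasDerivAt (fun x => v x t) vθ θ ∧ HasDerivAt (fun s => v θ s) vt t ∧ vt + c * vθ = m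

theorem HasTransportDerivAt.neg {v : ℝ → ℝ → ℝ} {c m θ t : ℝ}
    (hv : HasTransportDerivAt v c m θ t) :
    HasTransportDerivAt (fun x s => -v x s) c (-m) θ t := by
  obtain ⟨vθ, vt, hθ, ht, rfl⟩ := hv
  exact ⟨-vθ, -vt, hθ.neg, ht.neg, by ring⟩

theorem lt_barrier_of_transport {v : ℝ → ℝ → ℝ} {b b' : ℝ → ℝ} {t₀ t₁ P : ℝ} (hP : 0 < P)
    (hcont : ContinuousOn (Function.uncurry v) (univ ×ˢ Icc t₀ t₁))
    (hper : ∀ t ∈ Icc t₀ t₁, Function.Periodic (fun θ => v θ t) P)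
    (hb : ∀ t, HasDerivAt b (b' t) t) (hinit : ∀ θ, v θ t₀ < b t₀)
    (htouch : ∀ θ, ∀ t ∈ Ioc t₀ t₁, v θ t = b t →
      ∃ c m, HasTransportDerivAt v c m θ t ∧ m < b' t) :
    ∀ θ, ∀ t ∈ Icc t₀ t₁, v θ t < b t := by
  by_contra! hcross
  have hb_cont : Continuous b := continuous_iff_continuousAt.2 fun t => (hb t).continuousAt
  obtain ⟨θ, t, ht, hzero, hle⟩ := exists_first_zero_of_periodic (g := fun x s => v x s - b s) hP
    (hcont.sub (hb_cont.comp continuous_snd).continuousOn)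
    (fun s hs x => congrArg (· - b s) (hper s hs x))
    (fun x => sub_neg.2 (hinit x))
    (by simpa only [sub_nonneg] using hcross)
  obtain ⟨c, m, ⟨vθ, vt, hvθ, hvt, rfl⟩, hm⟩ := htouch θ t ht (sub_eq_zero.1 hzero)
  have hspace : IsLocalMax (fun x => v x t - b t) θ :=
    Eventually.of_forall fun x => (hle x t ⟨ht.1.le, le_rfl⟩).trans_eq hzero.symm
  have hvθ_zero : vθ = 0 := hspace.hasDerivAt_eq_zero (hvθ.sub_const _)
  have htime : IsMaxOn (fun s => v θ s - b s) (Icc t₀ t) t :=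
    fun s hs => (hle θ s hs).trans_eq hzero.symm
  have hvt_ge : 0 ≤ vt - b' t := nonneg_of_isMaxOn_right_endpoint ht.1 htime (hvt.sub (hb t))
  rw [hvθ_zero] at hm
  linarith

theorem hasDerivAt_fderiv_apply_comp {E F : Type*} [NormedAddCommGroup E] [NormedSpace ℝ E]
    [NormedAddCommGroup F] [NormedSpace ℝ F] {f : E → F} {γ : ℝ → E} {u : E} {s : ℝ}
    (hf : ContDiffAt ℝ 2 f (γ s)) (hγ : HasDerivAt γ u s) (e : E) :
    HasDerivAt (fun r => fderiv ℝ f (γ r) e) (fderiv ℝ (fderiv ℝ f) (γ s) u e) s := by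
  have hf' : HasFDerivAt (fderiv ℝ f) (fderiv ℝ (fderiv ℝ f) (γ s)) (γ s) :=
    ((hf.fderiv_right (m := 1) (by norm_num)).differentiableAt (by norm_num)).hasFDerivAt
  simpa using (hf'.comp_hasDerivAt s hγ).clm_apply (hasDerivAt_const s e)

theorem intervalIntegrable_and_integral_le_of_forall_lt {f : ℝ → ℝ} {a b I : ℝ} (hab : a ≤ b)
    (hI : 0 ≤ I) (hf : ∀ x, 0 ≤ f x)
    (h : ∀ t ∈ Ico a b, IntervalIntegrable f volume a t ∧ ∫ x in a..t, f x ≤ I) :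
    IntervalIntegrable f volume a b ∧ ∫ x in a..b, f x ≤ I := by
  rcases hab.eq_or_lt with rfl | hab
  · simpa using hI
  obtain ⟨u, -, hu, hu_lim⟩ := exists_seq_strictMono_tendsto' hab
  have hu' : ∀ n, u n ∈ Ico a b := fun n => Ioo_subset_Ico_self (hu n)
  have hint : IntervalIntegrable f volume a b := by
    refine (intervalIntegrable_iff_integrableOn_Ioc_of_le hab.le).2 <|
      integrableOn_Ioc_of_intervalIntegral_norm_bounded_right (I := I)
        (fun n => (h (u n) (hu' n)).1.1) hu_lim (Eventually.of_forall fun n => ?_)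
    rw [← intervalIntegral.integral_of_le (hu n).1.le]
    simpa only [Real.norm_of_nonneg (hf _)] using (h (u n) (hu' n)).2
  have hprimitive : ContinuousOn (fun t => ∫ x in a..t, f x) (Icc a b) :=
    uIcc_of_le hab.le ▸ intervalIntegral.continuousOn_primitive_interval' hint left_mem_uIcc
  have hlim : Tendsto u atTop (𝓝[Icc a b] b) :=
    tendsto_nhdsWithin_iff.2 ⟨hu_lim, Eventually.of_forall fun n => Ico_subset_Icc_self (hu' n)⟩
  exact ⟨hint, le_of_tendsto' ((hprimitive b (right_mem_Icc.2 hab.le)).tendsto.comp hlim)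
    fun n => (h (u n) (hu' n)).2⟩

section Regularity

variable {ε T θ t : ℝ} {f : ℝ → ℝ → ℝ}

namespace IsRegular

theorem hasFDerivWithinAt (hf : IsRegular ε T f) (ht : t ∈ timeInterval ε T) :
    HasFDerivWithinAt (Function.uncurry f)
      (fderivWithin ℝ (Function.uncurry f) (univ ×ˢ timeInterval ε T) (θ, t))
      (univ ×ˢ timeInterval ε T) (θ, t) :=
  (hf.contDiffOn.differentiableOn (by norm_num) (θ, t) ⟨mem_univ _, ht⟩).hasFDerivWithinAt

theorem hasDerivAt_fderivWithin_theta (hf : IsRegular ε T f) (ht : t ∈ timeInterval ε T) :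
    HasDerivAt (fun x => f x t)
      (fderivWithin ℝ (Function.uncurry f) (univ ×ˢ timeInterval ε T) (θ, t) (1, 0)) θ :=
  hasDerivWithinAt_univ.1 <| hf.hasFDerivWithinAt ht |>.comp_hasDerivWithinAt
    (f := fun x => (x, t)) θ ((hasDerivWithinAt_id θ univ).prodMk (hasDerivWithinAt_const θ univ t))
    fun _ _ => ⟨mem_univ _, ht⟩

theorem hasDerivWithinAt_comp_fderivWithin (hf : IsRegular ε T f) (ht : t ∈ timeInterval ε T)
    {η : ℝ → ℝ} {η' : ℝ} (hη : HasDerivWithinAt η η' (timeInterval ε T) t) :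
    HasDerivWithinAt (fun s => f (η s) s)
      (fderivWithin ℝ (Function.uncurry f) (univ ×ˢ timeInterval ε T) (η t, t) (η', 1))
      (timeInterval ε T) t :=
  (hf.hasFDerivWithinAt ht).comp_hasDerivWithinAt (f := fun s => (η s, s)) t
    (hη.prodMk (hasDerivWithinAt_id t _)) fun _ hs => ⟨mem_univ _, hs⟩

theorem dTheta_eq (hf : IsRegular ε T f) (ht : t ∈ timeInterval ε T) :
    dTheta f θ t =
      fderivWithin ℝ (Function.uncurry f) (univ ×ˢ timeInterval ε T) (θ, t) (1, 0) :=
  (hf.hasDerivAt_fderivWithin_theta ht).deriv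

theorem dTime_eq (hf : IsRegular ε T f) (ht : t ∈ timeInterval ε T) :
    dTime ε T f θ t =
      fderivWithin ℝ (Function.uncurry f) (univ ×ˢ timeInterval ε T) (θ, t) (0, 1) :=
  (hf.hasDerivWithinAt_comp_fderivWithin ht (hasDerivWithinAt_const t _ θ)).derivWithin
    (uniqueDiffOn_Ico _ _ t ht)

theorem hasDerivAt_dTheta (hf : IsRegular ε T f) (ht : t ∈ timeInterval ε T) :
    HasDerivAt (fun x => f x t) (dTheta f θ t) θ :=
  hf.dTheta_eq ht ▸ hf.hasDerivAt_fderivWithin_theta ht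

theorem hasDerivWithinAt_comp (hf : IsRegular ε T f) (ht : t ∈ timeInterval ε T)
    {η : ℝ → ℝ} {η' : ℝ} (hη : HasDerivWithinAt η η' (timeInterval ε T) t) :
    HasDerivWithinAt (fun s => f (η s) s) (dTime ε T f (η t) t + η' * dTheta f (η t) t)
      (timeInterval ε T) t := by
  have hdir : ((η', 1) : ℝ × ℝ) = (0, 1) + η' • (1, 0) := by simp
  have h := hf.hasDerivWithinAt_comp_fderivWithin ht hη
  rwa [hdir, map_add, map_smul, smul_eq_mul, ← hf.dTime_eq ht, ← hf.dTheta_eq ht] at h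

theorem hasDerivAt_dTime (hf : IsRegular ε T f) (ht : t ∈ Ioo (-ε) T) :
    HasDerivAt (fun s => f θ s) (dTime ε T f θ t) t := by
  have h := hf.hasDerivWithinAt_comp (Ioo_subset_Ico_self ht) (hasDerivWithinAt_const t _ θ)
  rw [zero_mul, add_zero] at h
  exact h.hasDerivAt (Ico_mem_nhds ht.1 ht.2)

theorem continuousOn_dTheta (hf : IsRegular ε T f) :
    ContinuousOn (Function.uncurry (dTheta f)) (univ ×ˢ timeInterval ε T) :=
  ((hf.contDiffOn.continuousOn_fderivWithin (uniqueDiffOn_univ.prod (uniqueDiffOn_Ico _ _))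
    (by norm_num)).clm_apply continuousOn_const).congr fun _ hp => hf.dTheta_eq hp.2

theorem periodic_dTheta (hf : IsRegular ε T f) (ht : t ∈ timeInterval ε T) :
    Function.Periodic (fun θ => dTheta f θ t) (2 * Real.pi) := fun θ => by
  simp only [dTheta]
  rw [← deriv_comp_add_const (fun x => f x t)]
  exact congrArg (deriv · θ) (funext (hf.periodic t ht))

theorem exists_hasDerivAt_mixed (hf : IsRegular ε T f) (θ : ℝ) (ht : t ∈ Ioo (-ε) T) :
    ∃ fθt fθθ, HasDerivAt (fun x => dTime ε T f x t) fθt θ ∧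
      HasDerivAt (fun s => dTheta f θ s) fθt t ∧ HasDerivAt (fun x => dTheta f x t) fθθ θ := by
  have hslab : ∀ x, ∀ s ∈ Ioo (-ε) T, (univ : Set ℝ) ×ˢ timeInterval ε T ∈ 𝓝 (x, s) :=
    fun x s hs => prod_mem_nhds univ_mem (Ico_mem_nhds hs.1 hs.2)
  have hdTime : ∀ x, dTime ε T f x t = fderiv ℝ (Function.uncurry f) (x, t) (0, 1) := fun x => by
    rw [hf.dTime_eq (Ioo_subset_Ico_self ht), fderivWithin_of_mem_nhds (hslab x t ht)]
  have hdTheta : ∀ x, ∀ s ∈ Ioo (-ε) T,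
      dTheta f x s = fderiv ℝ (Function.uncurry f) (x, s) (1, 0) := fun x s hs => by
    rw [hf.dTheta_eq (Ioo_subset_Ico_self hs), fderivWithin_of_mem_nhds (hslab x s hs)]
  have hC2 : ContDiffAt ℝ 2 (Function.uncurry f) (θ, t) := hf.contDiffOn.contDiffAt (hslab θ t ht)
  have hx : HasDerivAt (fun x : ℝ => (x, t)) (1, 0) θ :=
    (hasDerivAt_id θ).prodMk (hasDerivAt_const θ t)
  have hs : HasDerivAt (fun s : ℝ => (θ, s)) (0, 1) t :=
    (hasDerivAt_const t θ).prodMk (hasDerivAt_id t)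
  have hθt := hasDerivAt_fderiv_apply_comp (γ := fun x => (x, t)) hC2 hx (0, 1)
  have hθθ := hasDerivAt_fderiv_apply_comp (γ := fun x => (x, t)) hC2 hx (1, 0)
  have htθ := hasDerivAt_fderiv_apply_comp (γ := fun s => (θ, s)) hC2 hs (1, 0)
  rw [hC2.isSymmSndFDerivAt (by simp) (0, 1) (1, 0)] at htθ
  refine ⟨_, _, hθt.congr_of_eventuallyEq (Eventually.of_forall hdTime),
    htθ.congr_of_eventuallyEq ?_,
    hθθ.congr_of_eventuallyEq (Eventually.of_forall fun x => hdTheta x t ht)⟩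
  filter_upwards [Ioo_mem_nhds ht.1 ht.2] with s hs using hdTheta θ s hs

end IsRegular

end Regularity

/-- The equations for the Riemann variables `w`, `z` and the entropy `k` when the radial velocity
`a` is a prescribed function, differentiable in `θ`, instead of a solution of its own evolution
equation. -/
structure IsDrivenSolution (ε T : ℝ) (w z k a : ℝ → ℝ → ℝ) : Prop where
  regular_w : IsRegular ε T w
  regular_z : IsRegular ε T z
  regular_k : IsRegular ε T k
  hasDerivAt_a : ∀ θ, ∀ t ∈ timeInterval ε T, HasDerivAt (fun x => a x t) (dTheta a θ t) θ
  eq_w : ∀ θ, ∀ t ∈ timeInterval ε T,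
    dTime ε T w θ t + lam3 w z θ t * dTheta w θ t =
      -(8 / 3) * a θ t * w θ t + 1 / 24 * (w θ t - z θ t) ^ 2 * dTheta k θ t
  eq_z : ∀ θ, ∀ t ∈ timeInterval ε T,
    dTime ε T z θ t + lam1 w z θ t * dTheta z θ t =
      -(8 / 3) * a θ t * z θ t + 1 / 24 * (w θ t - z θ t) ^ 2 * dTheta k θ t
  eq_k : ∀ θ, ∀ t ∈ timeInterval ε T,
    dTime ε T k θ t + lam2 w z θ t * dTheta k θ t = 0

/-- The pointwise bounds behind the slope estimates, in the powers of `ε` that are invariant under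
rescaling `θ` and `t` by the same factor: each derivative costs `1 / ε`, and so does `a`, which acts
as a rate. -/
structure HasScaledBounds (M ε T : ℝ) (w z k a : ℝ → ℝ → ℝ) : Prop where
  initial_le : ∀ θ, |dTheta w θ (-ε)| ≤ M / ε
  w_le : ∀ θ, ∀ t ∈ timeInterval ε T, |w θ t| ≤ M
  c_sim : ∀ θ, ∀ t ∈ timeInterval ε T, 1 / M ≤ soundSpeed w z θ t ∧ soundSpeed w z θ t ≤ M
  a_le : ∀ θ, ∀ t ∈ timeInterval ε T, |a θ t| ≤ M / ε
  dz_le : ∀ θ, ∀ t ∈ timeInterval ε T, |dTheta z θ t| ≤ M / ε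
  dk_le : ∀ θ, ∀ t ∈ timeInterval ε T, |dTheta k θ t| ≤ M / ε
  da_le : ∀ θ, ∀ t ∈ timeInterval ε T, |dTheta a θ t| ≤ M / ε ^ 2

/-- The slope of `w` corrected by a multiple of the entropy gradient. The factor is
`c / 4`: since `λ₃ - λ₂ = 2 c / 3`, the correction cancels the term `c² / 6 * ∂_θ² k` in the
transport equation of `∂_θ w`. -/
noncomputable def goodSlope (w z k : ℝ → ℝ → ℝ) (θ t : ℝ) : ℝ :=
  dTheta w θ t - (w θ t - z θ t) / 8 * dTheta k θ t

/-- The coefficient of `-∂_θ w` in the Riccati equation for `goodSlope`. -/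
noncomputable def riccatiDamping (w z k a : ℝ → ℝ → ℝ) (θ t : ℝ) : ℝ :=
  dTheta z θ t / 3 + 8 / 3 * a θ t - (w θ t - z θ t) * dTheta k θ t / 6

/-- The part of the Riccati equation for `goodSlope` that does not involve `∂_θ w`. -/
noncomputable def riccatiSource (w z k a : ℝ → ℝ → ℝ) (θ t : ℝ) : ℝ :=
  -(8 / 3) * dTheta a θ t * w θ t +
    (w θ t - z θ t) * dTheta k θ t * (a θ t / 3 + dTheta z θ t / 12)

namespace IsDrivenSolution

variable {ε T : ℝ} {w z k a : ℝ → ℝ → ℝ}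

theorem hasTransportDerivAt_goodSlope (h : IsDrivenSolution ε T w z k a) (θ : ℝ) {t : ℝ}
    (ht : t ∈ Ioo (-ε) T) :
    HasTransportDerivAt (goodSlope w z k) (lam3 w z θ t)
      (-dTheta w θ t ^ 2 - riccatiDamping w z k a θ t * dTheta w θ t + riccatiSource w z k a θ t)
      θ t := by
  have ht' : t ∈ timeInterval ε T := Ioo_subset_Ico_self ht
  obtain ⟨wθt, wθθ, hwt_θ, hwθ_t, hwθ_θ⟩ := h.regular_w.exists_hasDerivAt_mixed θ ht
  obtain ⟨kθt, kθθ, hkt_θ, hkθ_t, hkθ_θ⟩ := h.regular_k.exists_hasDerivAt_mixed θ ht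
  have hw := h.regular_w.hasDerivAt_dTheta (θ := θ) ht'
  have hz := h.regular_z.hasDerivAt_dTheta (θ := θ) ht'
  have ha := h.hasDerivAt_a θ t ht'
  have hwt := h.regular_w.hasDerivAt_dTime (θ := θ) ht
  have hzt := h.regular_z.hasDerivAt_dTime (θ := θ) ht
  have eq_w_θ := (hwt_θ.add ((hw.add (hz.const_mul (1 / 3))).mul hwθ_θ)).unique
    ((((ha.const_mul (-(8 / 3))).mul hw).add
      ((((hw.sub hz).pow 2).const_mul (1 / 24)).mul hkθ_θ)).congr_of_eventuallyEq
      (Eventually.of_forall fun x => h.eq_w x t ht'))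
  have eq_k_θ := (hkt_θ.add (((hw.const_mul (2 / 3)).add (hz.const_mul (2 / 3))).mul hkθ_θ)).unique
    ((hasDerivAt_const θ (0 : ℝ)).congr_of_eventuallyEq
      (Eventually.of_forall fun x => h.eq_k x t ht'))
  have eq_w := h.eq_w θ t ht'
  have eq_z := h.eq_z θ t ht'
  refine ⟨_, _, hwθ_θ.sub (((hw.sub hz).div_const 8).mul hkθ_θ),
    hwθ_t.sub (((hwt.sub hzt).div_const 8).mul hkθ_t), ?_⟩
  simp only [lam1, lam3, riccatiDamping, riccatiSource, Pi.add_apply, Pi.sub_apply,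
    Pi.pow_apply] at *
  push_cast at eq_w_θ
  linear_combination
    eq_w_θ - (w θ t - z θ t) / 8 * eq_k_θ - dTheta k θ t / 8 * (eq_w - eq_z)

theorem continuousOn_goodSlope (h : IsDrivenSolution ε T w z k a) :
    ContinuousOn (Function.uncurry (goodSlope w z k)) (univ ×ˢ timeInterval ε T) :=
  h.regular_w.continuousOn_dTheta.sub
    (((h.regular_w.contDiffOn.continuousOn.sub h.regular_z.contDiffOn.continuousOn).div_const 8).mul
      h.regular_k.continuousOn_dTheta)

theorem periodic_goodSlope (h : IsDrivenSolution ε T w z k a) {t : ℝ}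
    (ht : t ∈ timeInterval ε T) :
    Function.Periodic (fun θ => goodSlope w z k θ t) (2 * Real.pi) := by
  intro θ
  have hw : w (θ + 2 * Real.pi) t = w θ t := h.regular_w.periodic t ht θ
  have hz : z (θ + 2 * Real.pi) t = z θ t := h.regular_z.periodic t ht θ
  have hwθ : dTheta w (θ + 2 * Real.pi) t = dTheta w θ t := h.regular_w.periodic_dTheta ht θ
  have hkθ : dTheta k (θ + 2 * Real.pi) t = dTheta k θ t := h.regular_k.periodic_dTheta ht θ
  simp only [goodSlope, hw, hz, hwθ, hkθ]

end IsDrivenSolution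

section SlopeBounds

variable {M ε T θ t : ℝ} {w z k a : ℝ → ℝ → ℝ}

namespace HasScaledBounds

theorem abs_sub_le (hB : HasScaledBounds M ε T w z k a) (hM : 0 < M)
    (ht : t ∈ timeInterval ε T) : |w θ t - z θ t| ≤ 2 * M := by
  obtain ⟨hc_ge, hc_le⟩ := hB.c_sim θ t ht
  have hc_pos : 0 < soundSpeed w z θ t := (one_div_pos.2 hM).trans_le hc_ge
  have hc : w θ t - z θ t = 2 * soundSpeed w z θ t := by rw [soundSpeed]; ring
  rw [hc, abs_of_pos (by positivity)]
  linarith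

theorem sub_w_div_le (hB : HasScaledBounds M ε T w z k a) {φ θ' t' : ℝ}
    (ht : t ∈ timeInterval ε T) (ht' : t' ∈ timeInterval ε T) :
    (w θ t - w θ' t') / (2 * φ) ≤ M / |φ| := by
  calc (w θ t - w θ' t') / (2 * φ)
      ≤ |w θ t - w θ' t'| / (2 * |φ|) := by
        simpa only [abs_div, abs_mul, Nat.abs_ofNat] using le_abs_self ((w θ t - w θ' t') / (2 * φ))
    _ ≤ (M + M) / (2 * |φ|) := by
        gcongr
        exact (abs_sub _ _).trans (add_le_add (hB.w_le θ t ht) (hB.w_le θ' t' ht'))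
    _ = M / |φ| := by rw [← two_mul, mul_div_mul_left _ _ two_ne_zero]

theorem abs_dTheta_sub_goodSlope_le (hB : HasScaledBounds M ε T w z k a) (hM : 0 < M)
    (ht : t ∈ timeInterval ε T) :
    |dTheta w θ t - goodSlope w z k θ t| ≤ M ^ 2 / ε / 4 := by
  calc |dTheta w θ t - goodSlope w z k θ t|
      = |w θ t - z θ t| / 8 * |dTheta k θ t| := by
        rw [goodSlope, sub_sub_cancel, abs_mul, abs_div, abs_of_pos (by norm_num : (0 : ℝ) < 8)]
    _ ≤ 2 * M / 8 * (M / ε) := by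
        gcongr
        exacts [hB.abs_sub_le hM ht, hB.dk_le θ t ht]
    _ = M ^ 2 / ε / 4 := by ring

theorem abs_goodSlope_initial_le (hB : HasScaledBounds M ε T w z k a) (hM : 1 ≤ M) (hε : 0 < ε)
    (h₀ : -ε ∈ timeInterval ε T) : |goodSlope w z k θ (-ε)| ≤ 5 / 4 * (M ^ 2 / ε) := by
  have hw : |dTheta w θ (-ε)| ≤ M ^ 2 / ε :=
    (hB.initial_le θ).trans (by gcongr; nlinarith)
  have hdiff := hB.abs_dTheta_sub_goodSlope_le (θ := θ) (by linarith) h₀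
  rw [abs_le] at *
  constructor <;> linarith

theorem abs_riccatiDamping_le (hB : HasScaledBounds M ε T w z k a) (hM : 1 ≤ M) (hε : 0 < ε)
    (ht : t ∈ timeInterval ε T) : |riccatiDamping w z k a θ t| ≤ 4 * (M ^ 2 / ε) := by
  have hM₀ : 0 < M := one_pos.trans_le hM
  calc |riccatiDamping w z k a θ t|
      ≤ |dTheta z θ t| / 3 + 8 / 3 * |a θ t| + |w θ t - z θ t| * |dTheta k θ t| / 6 := by
        refine (abs_sub _ _).trans (add_le_add ((abs_add_le _ _).trans_eq ?_) (le_of_eq ?_)) <;>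
          simp only [abs_mul, abs_div, Nat.abs_ofNat]
    _ ≤ M / ε / 3 + 8 / 3 * (M / ε) + 2 * M * (M / ε) / 6 := by
        gcongr
        exacts [hB.dz_le θ t ht, hB.a_le θ t ht, hB.abs_sub_le hM₀ ht, hB.dk_le θ t ht]
    _ = (3 * M + M ^ 2 / 3) / ε := by ring
    _ ≤ 4 * M ^ 2 / ε := by gcongr; nlinarith
    _ = 4 * (M ^ 2 / ε) := by ring

theorem abs_riccatiSource_le (hB : HasScaledBounds M ε T w z k a) (hM : 1 ≤ M) (hε : 0 < ε)
    (ht : t ∈ timeInterval ε T) : |riccatiSource w z k a θ t| ≤ 4 * (M ^ 2 / ε) ^ 2 := by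
  have hM₀ : 0 < M := one_pos.trans_le hM
  calc |riccatiSource w z k a θ t|
      ≤ 8 / 3 * |dTheta a θ t| * |w θ t| +
          |w θ t - z θ t| * |dTheta k θ t| * (|a θ t| / 3 + |dTheta z θ t| / 12) := by
        refine (abs_add_le _ _).trans (add_le_add (le_of_eq ?_) ?_)
        · simp only [abs_mul, abs_div, abs_neg, Nat.abs_ofNat]
        · rw [abs_mul, abs_mul]
          gcongr
          refine (abs_add_le _ _).trans_eq ?_
          simp only [abs_div, Nat.abs_ofNat]
    _ ≤ 8 / 3 * (M / ε ^ 2) * M + 2 * M * (M / ε) * (M / ε / 3 + M / ε / 12) := by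
        gcongr
        exacts [hB.da_le θ t ht, hB.w_le θ t ht, hB.abs_sub_le hM₀ ht, hB.dk_le θ t ht,
          hB.a_le θ t ht, hB.dz_le θ t ht]
    _ = (8 / 3 * M ^ 2 + 5 / 6 * M ^ 3) / ε ^ 2 := by ring
    _ ≤ (8 / 3 * M ^ 4 + 5 / 6 * M ^ 4) / ε ^ 2 := by gcongr <;> first | exact hM | norm_num
    _ ≤ 4 * M ^ 4 / ε ^ 2 := by gcongr; nlinarith [pow_pos hM₀ 4]
    _ = 4 * (M ^ 2 / ε) ^ 2 := by ring

theorem abs_source_w_le (hB : HasScaledBounds M ε T w z k a) (hM : 1 ≤ M) (hε : 0 < ε)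
    (ht : t ∈ timeInterval ε T) :
    |-(8 / 3) * a θ t * w θ t + 1 / 24 * (w θ t - z θ t) ^ 2 * dTheta k θ t| ≤
      3 * M ^ 3 / ε := by
  have hM₀ : 0 < M := one_pos.trans_le hM
  calc |-(8 / 3) * a θ t * w θ t + 1 / 24 * (w θ t - z θ t) ^ 2 * dTheta k θ t|
      ≤ 8 / 3 * |a θ t| * |w θ t| + 1 / 24 * |w θ t - z θ t| ^ 2 * |dTheta k θ t| := by
        refine (abs_add_le _ _).trans_eq ?_
        simp only [abs_mul, abs_div, abs_neg, abs_pow, abs_one, Nat.abs_ofNat]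
    _ ≤ 8 / 3 * (M / ε) * M + 1 / 24 * (2 * M) ^ 2 * (M / ε) := by
        gcongr
        exacts [hB.a_le θ t ht, hB.w_le θ t ht, hB.abs_sub_le hM₀ ht, hB.dk_le θ t ht]
    _ = (8 / 3 * M ^ 2 + 1 / 6 * M ^ 3) / ε := by ring
    _ ≤ 3 * M ^ 3 / ε := by gcongr; nlinarith [sq_nonneg M]

end HasScaledBounds

theorem riccati_neg {L P R W : ℝ} (hL : 0 < L) (hP : |P| ≤ 4 * L) (hR : |R| ≤ 4 * L ^ 2)
    (hW : 5 * L ≤ W) : -W ^ 2 - P * W + R < 0 := by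
  have hPW : -(4 * L) * W ≤ P * W := by
    gcongr
    exacts [by linarith, (abs_le.1 hP).1]
  nlinarith [(abs_le.1 hR).2]

theorem lt_riccati {L P R W : ℝ} (hL : 0 < L) (hP : |P| ≤ 4 * L) (hR : |R| ≤ 4 * L ^ 2)
    (hW : |W| ≤ 4 * L) : -(40 * L ^ 2) < -W ^ 2 - P * W + R := by
  have hWW : W ^ 2 ≤ (4 * L) ^ 2 := sq_le_sq' (abs_le.1 hW).1 (abs_le.1 hW).2
  have hPW : P * W ≤ 4 * L * (4 * L) :=
    (le_abs_self _).trans ((abs_mul P W).trans_le (by gcongr))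
  nlinarith [(abs_le.1 hR).1]

namespace IsDrivenSolution

theorem goodSlope_lt (h : IsDrivenSolution ε T w z k a) (hB : HasScaledBounds M ε T w z k a)
    (hM : 1 ≤ M) (hε : 0 < ε) (ht : t ∈ timeInterval ε T) :
    goodSlope w z k θ t < 6 * (M ^ 2 / ε) := by
  set L := M ^ 2 / ε
  have hL : 0 < L := by positivity
  have hsub : Icc (-ε) t ⊆ timeInterval ε T := Icc_subset_Ico_right ht.2
  refine lt_barrier_of_transport (b := fun _ => 6 * L) (b' := fun _ => 0) Real.two_pi_pos
    (h.continuousOn_goodSlope.mono (prod_mono_right hsub))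
    (fun s hs => h.periodic_goodSlope (hsub hs)) (fun s => hasDerivAt_const s _) (fun x => ?_)
    (fun x s hs hxs => ?_) θ t ⟨ht.1, le_rfl⟩
  · have hinit := (abs_le.1 (hB.abs_goodSlope_initial_le (θ := x) hM hε (hsub ⟨le_rfl, ht.1⟩))).2
    linarith
  · have hs' : s ∈ timeInterval ε T := hsub (Ioc_subset_Icc_self hs)
    have hdiff := abs_le.1 (hB.abs_dTheta_sub_goodSlope_le (θ := x) (by linarith) hs')
    exact ⟨_, _, h.hasTransportDerivAt_goodSlope x ⟨hs.1, hs'.2⟩,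
      riccati_neg hL (hB.abs_riccatiDamping_le hM hε hs') (hB.abs_riccatiSource_le hM hε hs')
        (by linarith)⟩

theorem neg_goodSlope_lt (h : IsDrivenSolution ε T w z k a) (hB : HasScaledBounds M ε T w z k a)
    (hM : 1 ≤ M) (hε : 0 < ε) (ht : t ∈ timeInterval ε T)
    (hearly : 40 * (M ^ 2 / ε) * (ε + t) ≤ 1) :
    -goodSlope w z k θ t < 3 * (M ^ 2 / ε) := by
  set L := M ^ 2 / ε
  have hL : 0 < L := by positivity
  have hsub : Icc (-ε) t ⊆ timeInterval ε T := Icc_subset_Ico_right ht.2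
  have hbarrier_le : ∀ s ≤ t, 2 * L + 40 * L ^ 2 * (ε + s) ≤ 3 * L := fun s hs => by
    nlinarith [mul_le_mul_of_nonneg_left hs (sq_nonneg L)]
  refine (lt_barrier_of_transport (v := fun x s => -goodSlope w z k x s)
    (b := fun s => 2 * L + 40 * L ^ 2 * (ε + s)) (b' := fun _ => 40 * L ^ 2) Real.two_pi_pos
    (h.continuousOn_goodSlope.mono (prod_mono_right hsub)).neg
    (fun s hs x => congrArg Neg.neg (h.periodic_goodSlope (hsub hs) x))
    (fun s => by
      simpa using (((hasDerivAt_id s).const_add ε).const_mul (40 * L ^ 2)).const_add (2 * L))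
    (fun x => ?_) (fun x s hs hxs => ?_) θ t ⟨ht.1, le_rfl⟩).trans_le (hbarrier_le t le_rfl)
  · have hinit := (abs_le.1 (hB.abs_goodSlope_initial_le (θ := x) hM hε (hsub ⟨le_rfl, ht.1⟩))).1
    rw [add_neg_cancel, mul_zero]
    linarith
  · have hs' : s ∈ timeInterval ε T := hsub (Ioc_subset_Icc_self hs)
    have hdiff := abs_le.1 (hB.abs_dTheta_sub_goodSlope_le (θ := x) (by linarith) hs')
    have hbarrier_ge : 0 ≤ 40 * L ^ 2 * (ε + s) :=
      mul_nonneg (by positivity) (by linarith [hs.1])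
    have hslope : |dTheta w x s| ≤ 4 * L :=
      abs_le.2 ⟨by linarith [hbarrier_le s hs.2], by linarith [hbarrier_le s hs.2]⟩
    exact ⟨_, _, (h.hasTransportDerivAt_goodSlope x ⟨hs.1, hs'.2⟩).neg,
      neg_lt.1 (lt_riccati hL (hB.abs_riccatiDamping_le hM hε hs')
        (hB.abs_riccatiSource_le hM hε hs') hslope)⟩

theorem dTheta_w_le (h : IsDrivenSolution ε T w z k a) (hB : HasScaledBounds M ε T w z k a)
    (hM : 1 ≤ M) (hε : 0 < ε) (ht : t ∈ timeInterval ε T) :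
    dTheta w θ t ≤ 7 * (M ^ 2 / ε) := by
  have hL : 0 < M ^ 2 / ε := by positivity
  have hdiff := abs_le.1 (hB.abs_dTheta_sub_goodSlope_le (θ := θ) (by linarith) ht)
  linarith [h.goodSlope_lt hB hM hε (θ := θ) ht]

theorem abs_dTheta_w_le_of_early (h : IsDrivenSolution ε T w z k a)
    (hB : HasScaledBounds M ε T w z k a) (hM : 1 ≤ M) (hε : 0 < ε) (ht : t ∈ timeInterval ε T)
    (hearly : 40 * (M ^ 2 / ε) * (ε + t) ≤ 1) :
    |dTheta w θ t| ≤ 7 * (M ^ 2 / ε) := by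
  have hL : 0 < M ^ 2 / ε := by positivity
  have hdiff := abs_le.1 (hB.abs_dTheta_sub_goodSlope_le (θ := θ) (by linarith) ht)
  refine abs_le.2 ⟨?_, h.dTheta_w_le hB hM hε ht⟩
  linarith [h.neg_goodSlope_lt hB hM hε (θ := θ) ht hearly]

end IsDrivenSolution

end SlopeBounds

section IntegralAlongCurve

variable {M ε T φ θ t : ℝ} {w z k a : ℝ → ℝ → ℝ} {η : ℝ → ℝ}

namespace IsDrivenSolution

theorem dTime_w_add_speed_mul_dTheta_w (h : IsDrivenSolution ε T w z k a)
    (ht : t ∈ timeInterval ε T) :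
    dTime ε T w θ t + speed φ w z θ t * dTheta w θ t =
      -(8 / 3) * a θ t * w θ t + 1 / 24 * (w θ t - z θ t) ^ 2 * dTheta k θ t -
        2 * φ * (soundSpeed w z θ t * dTheta w θ t) := by
  rw [← h.eq_w θ t ht, soundSpeed, speed, lam3]
  ring

theorem abs_dTheta_w_le_add_transport (h : IsDrivenSolution ε T w z k a)
    (hB : HasScaledBounds M ε T w z k a) (hM : 1 ≤ M) (hε : 0 < ε) (hφ : φ ≠ 0)
    (ht : t ∈ timeInterval ε T) :
    |dTheta w θ t| ≤ M * (14 * M ^ 3 / ε + 3 * M ^ 3 / ε / (2 * |φ|) +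
      (dTime ε T w θ t + speed φ w z θ t * dTheta w θ t) / (2 * φ)) := by
  have hM₀ : 0 < M := one_pos.trans_le hM
  set S := -(8 / 3) * a θ t * w θ t + 1 / 24 * (w θ t - z θ t) ^ 2 * dTheta k θ t
  set D := dTime ε T w θ t + speed φ w z θ t * dTheta w θ t
  set W := dTheta w θ t
  set c := soundSpeed w z θ t
  obtain ⟨hc_ge, hc_le⟩ := hB.c_sim θ t ht
  have hc_pos : 0 < c := (one_div_pos.2 hM₀).trans_le hc_ge
  have hMc : 1 ≤ M * c := by rwa [div_le_iff₀' hM₀] at hc_ge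
  have hcW : -(c * W) = D / (2 * φ) - S / (2 * φ) := by
    have hD : D = S - 2 * φ * (c * W) := h.dTime_w_add_speed_mul_dTheta_w ht
    rw [hD]
    field_simp
    ring
  have hS_le : -(S / (2 * φ)) ≤ 3 * M ^ 3 / ε / (2 * |φ|) := by
    refine (neg_le_abs _).trans ?_
    rw [abs_div, abs_mul, Nat.abs_ofNat]
    gcongr
    exact hB.abs_source_w_le hM hε ht
  have hW_abs : |W| ≤ 14 * (M ^ 2 / ε) - W := by
    have hW_le := h.dTheta_w_le hB hM hε (θ := θ) ht
    have hL : 0 < M ^ 2 / ε := by positivity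
    exact abs_le'.2 ⟨by linarith, by linarith⟩
  calc |W| ≤ M * c * |W| := le_mul_of_one_le_left (abs_nonneg W) hMc
    _ ≤ M * c * (14 * (M ^ 2 / ε) - W) := by gcongr
    _ = M * (14 * (M ^ 2 / ε) * c - c * W) := by ring
    _ ≤ M * (14 * (M ^ 2 / ε) * M + -(c * W)) := by rw [sub_eq_add_neg]; gcongr
    _ = M * (14 * M ^ 3 / ε + -(S / (2 * φ)) + D / (2 * φ)) := by rw [hcW]; ring
    _ ≤ M * (14 * M ^ 3 / ε + 3 * M ^ 3 / ε / (2 * |φ|) + D / (2 * φ)) := by gcongr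

theorem continuousOn_abs_dTheta_w_comp (h : IsDrivenSolution ε T w z k a)
    (hη : IsIntegralCurveOn η (fun t θ => speed φ w z θ t) (timeInterval ε T)) :
    ContinuousOn (fun τ => |dTheta w (η τ) τ|) (timeInterval ε T) :=
  (h.regular_w.continuousOn_dTheta.comp (hη.continuousOn.prodMk continuousOn_id)
    fun _ hτ => ⟨mem_univ _, hτ⟩).abs

theorem integral_abs_dTheta_w_le_of_early (h : IsDrivenSolution ε T w z k a)
    (hB : HasScaledBounds M ε T w z k a) (hM : 1 ≤ M) (hε : 0 < ε)
    (ht : t ∈ timeInterval ε T) (hearly : 40 * (M ^ 2 / ε) * (ε + t) ≤ 1) :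
    ∫ τ in (-ε)..t, |dTheta w (η τ) τ| ≤ 7 * M ^ 2 * ((ε + t) / ε) := by
  have hslope : ∀ τ ∈ uIoc (-ε) t, ‖|dTheta w (η τ) τ|‖ ≤ 7 * (M ^ 2 / ε) := fun τ hτ => by
    rw [uIoc_of_le ht.1] at hτ
    rw [Real.norm_eq_abs, abs_abs]
    exact h.abs_dTheta_w_le_of_early hB hM hε ⟨hτ.1.le, hτ.2.trans_lt ht.2⟩
      (hearly.trans' (by gcongr; exact hτ.2))
  calc ∫ τ in (-ε)..t, |dTheta w (η τ) τ|
      ≤ 7 * (M ^ 2 / ε) * |t - -ε| :=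
        (le_abs_self _).trans (intervalIntegral.norm_integral_le_of_norm_le_const hslope)
    _ = 7 * M ^ 2 * ((ε + t) / ε) := by
        rw [abs_of_nonneg (sub_nonneg.2 ht.1)]
        ring

theorem integral_abs_dTheta_w_le (h : IsDrivenSolution ε T w z k a)
    (hB : HasScaledBounds M ε T w z k a) (hM : 1 ≤ M) (hε : 0 < ε) (hφ : φ ≠ 0)
    (hη : IsIntegralCurveOn η (fun t θ => speed φ w z θ t) (timeInterval ε T))
    (ht : t ∈ timeInterval ε T) :
    ∫ τ in (-ε)..t, |dTheta w (η τ) τ| ≤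
      M * (14 * M ^ 3 * ((ε + t) / ε) + (3 / 2 * M ^ 3 * ((ε + t) / ε) + M) / |φ|) := by
  have hsub : Icc (-ε) t ⊆ timeInterval ε T := Icc_subset_Ico_right ht.2
  set A := 14 * M ^ 3 / ε + 3 * M ^ 3 / ε / (2 * |φ|) with hA
  let G : ℝ → ℝ := fun τ => M * (A * τ + w (η τ) τ / (2 * φ))
  have hG : ∀ τ ∈ timeInterval ε T, HasDerivWithinAt G
      (M * (A + (dTime ε T w (η τ) τ + speed φ w z (η τ) τ * dTheta w (η τ) τ) / (2 * φ)))
      (timeInterval ε T) τ := fun τ hτ => by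
    simpa using (((hasDerivWithinAt_id τ _).const_mul A).add
      ((h.regular_w.hasDerivWithinAt_comp hτ (hη τ hτ)).div_const (2 * φ))).const_mul M
  have hincrement : (w (η t) t - w (η (-ε)) (-ε)) / (2 * φ) ≤ M / |φ| :=
    hB.sub_w_div_le ht (hsub (left_mem_Icc.2 ht.1))
  calc ∫ τ in (-ε)..t, |dTheta w (η τ) τ|
      ≤ G t - G (-ε) := by
        refine intervalIntegral.integral_le_sub_of_hasDeriv_right_of_le ht.1
          (fun τ hτ => ((hG τ (hsub hτ)).mono hsub).continuousWithinAt)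
          (fun τ hτ => ?_)
          ((h.continuousOn_abs_dTheta_w_comp hη).mono hsub).integrableOn_Icc
          (fun τ hτ => h.abs_dTheta_w_le_add_transport hB hM hε hφ (hsub (Ioo_subset_Icc_self hτ)))
        have hτT := hsub (Ioo_subset_Icc_self hτ)
        exact ((hG τ hτT).hasDerivAt (Ico_mem_nhds hτ.1 hτT.2)).hasDerivWithinAt
    _ = M * (A * (ε + t) + (w (η t) t - w (η (-ε)) (-ε)) / (2 * φ)) := by
        simp only [G]
        ring
    _ ≤ M * (A * (ε + t) + M / |φ|) := by gcongr
    _ = M * (14 * M ^ 3 * ((ε + t) / ε) + (3 / 2 * M ^ 3 * ((ε + t) / ε) + M) / |φ|) := by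
        rw [hA]
        field_simp
        ring

theorem integral_abs_dTheta_w_le_linear (h : IsDrivenSolution ε T w z k a)
    (hB : HasScaledBounds M ε T w z k a) (hM : 1 ≤ M) (hε : 0 < ε) (hφ : φ ≠ 0)
    (hη : IsIntegralCurveOn η (fun t θ => speed φ w z θ t) (timeInterval ε T))
    (ht : t ∈ timeInterval ε T) :
    ∫ τ in (-ε)..t, |dTheta w (η τ) τ| ≤ 56 * M ^ 4 * max 1 (1 / |φ|) * ((ε + t) / ε) := by
  have hs : 0 ≤ (ε + t) / ε := div_nonneg (by linarith [ht.1]) hε.le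
  have hearly_eq : 40 * (M ^ 2 / ε) * (ε + t) = 40 * M ^ 2 * ((ε + t) / ε) := by ring
  set s := (ε + t) / ε
  set m := max 1 (1 / |φ|)
  have hm_one : 1 ≤ m := le_max_left _ _
  have hM4 : M ^ 2 ≤ M ^ 4 := pow_le_pow_right₀ hM (by norm_num)
  rcases le_total (40 * M ^ 2 * s) 1 with hearly | hlate
  · calc ∫ τ in (-ε)..t, |dTheta w (η τ) τ|
        ≤ 7 * M ^ 2 * s :=
          h.integral_abs_dTheta_w_le_of_early hB hM hε ht (hearly_eq.trans_le hearly)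
      _ ≤ 56 * M ^ 4 * 1 * s := by gcongr ?_ * s; linarith [sq_nonneg M]
      _ ≤ 56 * M ^ 4 * m * s := by gcongr
  · calc ∫ τ in (-ε)..t, |dTheta w (η τ) τ|
        ≤ M * (14 * M ^ 3 * s + (3 / 2 * M ^ 3 * s + M) / |φ|) :=
          h.integral_abs_dTheta_w_le hB hM hε hφ hη ht
      _ = 14 * M ^ 4 * s * 1 + (3 / 2 * M ^ 4 * s + M ^ 2 * 1) * (1 / |φ|) := by ring
      _ ≤ 14 * M ^ 4 * s * m + (3 / 2 * M ^ 4 * s + M ^ 2 * (40 * M ^ 2 * s)) * m := by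
          gcongr
          exact le_max_right _ _
      _ = 111 / 2 * M ^ 4 * m * s := by ring
      _ ≤ 56 * M ^ 4 * m * s := by gcongr; norm_num

end IsDrivenSolution

end IntegralAlongCurve

theorem IsSolution.isDrivenSolution {ε T : ℝ} {w z k a : ℝ → ℝ → ℝ}
    (h : IsSolution ε T w z k a) : IsDrivenSolution ε T w z k a where
  __ := h
  hasDerivAt_a _ _ ht := h.regular_a.hasDerivAt_dTheta ht

theorem HasBounds.hasScaledBounds {M β₁ γ₁ ε T : ℝ} {w z k a : ℝ → ℝ → ℝ}
    (hB : HasBounds M β₁ γ₁ ε T w z k a) (hM : 1 ≤ M) (hβ₁ : -1 ≤ β₁) (hγ₁ : -1 ≤ γ₁)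
    (hε : 0 < ε) (hε_le : ε ≤ 1) (hinit : ∀ θ, |dTheta w θ (-ε)| ≤ 1 / ε) :
    HasScaledBounds M ε T w z k a := by
  have hM₀ : 0 < M := one_pos.trans_le hM
  have hrpow : ∀ β : ℝ, -1 ≤ β → M * ε ^ β ≤ M / ε := fun β hβ => by
    rw [div_eq_mul_inv, ← Real.rpow_neg_one]
    exact mul_le_mul_of_nonneg_left (Real.rpow_le_rpow_of_exponent_ge hε hε_le hβ) hM₀.le
  exact
    { initial_le := fun θ => (hinit θ).trans (by gcongr)
      w_le := fun θ t ht => by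
        obtain ⟨hw_ge, hw_le⟩ := hB.w_sim θ t ht
        rwa [abs_of_pos ((one_div_pos.2 hM₀).trans_le hw_ge)]
      c_sim := hB.c_sim
      a_le := fun θ t ht => (hB.a_le θ t ht).trans (le_div_self hM₀.le hε hε_le)
      dz_le := fun θ t ht => (hB.dz_le θ t ht).trans (hrpow β₁ hβ₁)
      dk_le := fun θ t ht => (hB.dk_le θ t ht).trans (hrpow γ₁ hγ₁)
      da_le := fun θ t ht => (hB.da_le θ t ht).trans
        (le_div_self hM₀.le (by positivity) (pow_le_one₀ hε.le hε_le)) }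

end AzimuthalEuler

open AzimuthalEuler Set MeasureTheory in
theorem lemma3p1_general {M ε T φ t : ℝ} {w z k a : ℝ → ℝ → ℝ} {η : ℝ → ℝ} (hM : 1 ≤ M)
    (hε : 0 < ε) (h : IsDrivenSolution ε T w z k a) (hB : HasScaledBounds M ε T w z k a)
    (hφ : φ ≠ 0) (hη : IsIntegralCurveOn η (fun t θ => speed φ w z θ t) (timeInterval ε T))
    (ht : t ∈ Icc (-ε) T) :
    IntervalIntegrable (fun τ => |dTheta w (η τ) τ|) volume (-ε) t ∧
      ∫ τ in (-ε)..t, |dTheta w (η τ) τ| ≤ 56 * M ^ 4 * max 1 (1 / |φ|) * ((ε + t) / ε) := by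
  have hbound_nonneg : 0 ≤ 56 * M ^ 4 * max 1 (1 / |φ|) * ((ε + t) / ε) :=
    mul_nonneg (by positivity) (div_nonneg (by linarith [ht.1]) hε.le)
  refine intervalIntegrable_and_integral_le_of_forall_lt ht.1 hbound_nonneg
    (fun _ => abs_nonneg _) fun s hs => ?_
  have hsT : s ∈ timeInterval ε T := ⟨hs.1, hs.2.trans_le ht.2⟩
  constructor
  · refine ((h.continuousOn_abs_dTheta_w_comp hη).mono ?_).intervalIntegrable_of_Icc hs.1
    exact Icc_subset_Ico_right hsT.2
  · refine (h.integral_abs_dTheta_w_le_linear hB hM hε hφ hη hsT).trans ?_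
    gcongr
    exact hs.2.le

theorem lemma3p1 (M : ℝ) (hM : 1 ≤ M) :
    ∃ C : ℝ, 0 < C ∧
      ∀ (β₁ γ₁ : ℝ), -1 < β₁ → 0 < γ₁ →
      ∀ (ε T : ℝ), 0 < ε → ε ≤ 1 → -ε ≤ T → T ≤ ε →
      ∀ (w z k a : ℝ → ℝ → ℝ),
        AzimuthalEuler.IsSolution ε T w z k a →
        (∀ θ : ℝ, |AzimuthalEuler.dTheta w θ (-ε)| ≤ 1 / ε) →
        AzimuthalEuler.HasBounds M β₁ γ₁ ε T w z k a →
      ∀ (φ : ℝ), 0 < φ →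
      ∀ (Ψ : ℝ → ℝ → ℝ), AzimuthalEuler.IsFlow ε T (AzimuthalEuler.speed φ w z) Ψ →
      ∀ (x t : ℝ), t ∈ Set.Icc (-ε) T →
        IntervalIntegrable (fun τ => |AzimuthalEuler.dTheta w (Ψ x τ) τ|)
            MeasureTheory.volume (-ε) t ∧
          ∫ τ in (-ε)..t, |AzimuthalEuler.dTheta w (Ψ x τ) τ| ≤
            C * max 1 (1 / φ) * ((ε + t) / ε) := by
  refine ⟨56 * M ^ 4, by positivity, ?_⟩
  intro β₁ γ₁ hβ₁ hγ₁ ε T hε hε_le _ _ w z k a h hinit hB φ hφ Ψ hΨ x t ht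
  have hB' := hB.hasScaledBounds hM hβ₁.le (by linarith) hε hε_le hinit
  simpa only [abs_of_pos hφ] using
    lemma3p1_general hM hε h.isDrivenSolution hB' hφ.ne' (hΨ.hasDeriv x) ht
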